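/- Let $n,r,d\ge 0$ be integers. Put $[d]=\{1,\dots,d\}$, let $\mathcal M_d$ be the complex $d\times d$ matrices, and let $\Pi^{(n)}_d=\frac1{n!}\sum_{\pi\in S_n}P_\pi$ be the orthogonal projection of $(\mathbb C^d)^{\otimes n}$ onto the symmetric subspace $\vee^n\mathbb C^d$ ($P_\pi$ permutes the tensor factors). Let $\mathrm{Herm}[\vee^n\mathbb C^d]$ be the real space of Hermitian $X\in\mathcal M_d^{\otimes n}$ with $\Pi^{(n)}_dX\Pi^{(n)}_d=X$. An operator $O\in\mathcal M_d^{\otimes n}$ is diagonally symmetric, $O\in\mathsf{DS}^{(n)}_d$, if $\Pi^{(n)}_dO\,\Pi^{(n)}_d=O$ and $O$ commutes with $U^{\otimes n}$ for every diagonal unitary $U\in\mathcal M_d$. *Extendibility witnesses.* Let $\mathsf{PSD}^{(m)}_d$ be the set of positive semidefinite $X\in\mathrm{Herm}[\vee^m\mathbb C^d]$, and $\mathsf{PPT}^{(m)}_d$ the set of $X\in\mathrm{Herm}[\vee^m\mathbb C^d]$ such that $X^{\Gamma_{[k]}}\succeq0$ for all $0\le k\le\lfloor m/2\rfloor$, where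 $\Gamma_{[k]}$ is the partial transpose on the first $k$ tensor factors. With $\mathrm{Tr}_{[r]}$ the partial trace over $r$ tensor factors, let $$\mathsf{BExt}^{(n,r)}_d=\{X\in\mathrm{Herm}[\vee^n\mathbb C^d]\mid \exists\,\tilde X\in\mathsf{PSD}^{(n+r)}_d,\ \mathrm{Tr}_{[r]}\tilde X=X\},$$ $$\mathsf{PPTBExt}^{(n,r)}_d=\{X\in\mathrm{Herm}[\vee^n\mathbb C^d]\mid \exists\,\tilde X\in\mathsf{PPT}^{(n+r)}_d,\ \mathrm{Tr}_{[r]}\tilde X=X\}.$$ The bosonic-extendibility witnesses $\mathsf{ExtW}^{(n,r)}_d$ and the PPT-extendibility witnesses $\mathsf{DecExtW}^{(n,r)}_d$ are the conic duals of these two cones in $\mathrm{Herm}[\vee^n\mathbb C^d]$: the sets of $O\in\mathrm{Herm}[\vee^n\mathbb C^d]$ with $\mathrm{Tr}(O^*X)\ge0$ for all $X$ in $\mathsf{BExt}^{(n,r)}_d$, respectively in $\mathsf{PPTBExt}^{(n,r)}_d$. *Tensor hierarchies.* For a real symmetric tensor $T\in\vee^n\mathbb R^d$ let $p_T(x)=\sum_{i\in[d]^n}T_i\,x_{i_1}\cdots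 x_{i_n}$. Pólya's nonnegative hierarchy $\mathsf{PNN}^{(n,r)}_d$ is the set of $T\in\vee^n\mathbb R^d$ such that $p_T(x)\,(x_1+\cdots+x_d)^r$ has only nonnegative coefficients. Reznick's sum-of-squares hierarchy $\mathsf{RSOS}^{(n,r)}_d$ is the set of $T\in\vee^n\mathbb R^d$ such that $p_T(x_1^2,\dots,x_d^2)\,(x_1^2+\cdots+x_d^2)^r$ is a finite sum of squares of real homogeneous polynomials of degree $n+r$. For $O\in\mathsf{DS}^{(n)}_d$ let $W[O]$ be the tensor $$W[O]_i=\frac{n!}{\gamma(i)_1!\cdots\gamma(i)_d!}\,\langle i|O|i\rangle,\qquad i\in[d]^n,\quad \gamma(i)_j=\#\{k\mid i_k=j\}.$$ **Corollary.** For every $O\in\mathsf{DS}^{(n)}_d$: 1. $O\in\mathsf{ExtW}^{(n,r)}_d$ if and only if $W[O]\in\mathsf{PNN}^{(n,r)}_d$; 2. $O\in\mathsf{DecExtW}^{(n,r)}_d$ if and only if $W[O]\in\mathsf{RSOS}^{(n,r)}_d$. (Membership of $W[O]$ in one of these sets includes that all its entries are real.) -/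

import Mathlib

open scoped ComplexOrder Matrix

namespace Dicke

/-- Multi-indices in `[d]^n`. -/
abbrev MIdx (n d : ℕ) : Type := Fin n → Fin d

/-- Operators on `(ℂ^d)^{⊗ n}`, as matrices in the computational basis `|i⟩`, `i ∈ [d]^n`. -/
abbrev Op (n d : ℕ) : Type := Matrix (MIdx n d) (MIdx n d) ℂ

/-! ### The symmetric subspace and bosonic operators -/

/-- The permutation operator `P_π = ∑_i |i_{π⁻¹(1)} ⋯ i_{π⁻¹(n)}⟩⟨i_1 ⋯ i_n|`. -/
def permOp (n d : ℕ) (π : Equiv.Perm (Fin n)) : Op n d :=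
  Matrix.of fun a i => if a = i ∘ ⇑π⁻¹ then 1 else 0

/-- The projection `Π = (1 / n!) ∑_π P_π` onto the symmetric subspace `∨^n ℂ^d`. -/
noncomputable def symProj (n d : ℕ) : Op n d :=
  (1 / (n.factorial : ℂ)) • ∑ π : Equiv.Perm (Fin n), permOp n d π

/-- `Herm[∨^n ℂ^d]`: Hermitian operators with `Π X Π = X`. -/
def HermBos (n d : ℕ) : Set (Op n d) :=
  {X | X.IsHermitian ∧ symProj n d * X * symProj n d = X}

/-! ### Diagonally symmetric operators and the tensor `W` -/

/-- The diagonal unitary `U_θ = diag(e^{i θ_1}, …, e^{i θ_d})`. -/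
noncomputable def diagUnitary {d : ℕ} (θ : Fin d → ℝ) : Matrix (Fin d) (Fin d) ℂ :=
  Matrix.diagonal fun j => Complex.exp (Complex.I * (θ j : ℂ))

/-- The tensor power `A^{⊗ n}` of a matrix `A`. -/
def tensorPow {d : ℕ} (n : ℕ) (A : Matrix (Fin d) (Fin d) ℂ) : Op n d :=
  Matrix.of fun i j => ∏ k, A (i k) (j k)

/-- The diagonally symmetric operators: `Π X Π = X`, and `X` commutes with `U^{⊗ n}` for every
diagonal unitary `U`. -/
def DS (n d : ℕ) : Set (Op n d) :=
  {X | symProj n d * X * symProj n d = X ∧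
    ∀ θ : Fin d → ℝ, tensorPow n (diagUnitary θ) * X = X * tensorPow n (diagUnitary θ)}

/-- The occupation vector `γ(i)_j = #{k | i_k = j}`. -/
def occ {n d : ℕ} (i : MIdx n d) (j : Fin d) : ℕ :=
  (Finset.univ.filter fun k => i k = j).card

/-- The tensor `W[X]_i = ⟨i|X|i⟩ * n! / (γ(i)_1! ⋯ γ(i)_d!)`. -/
def wTensor {n d : ℕ} (X : Op n d) (i : MIdx n d) : ℂ :=
  X i i * (Nat.multinomial Finset.univ (occ i) : ℂ)

/-! ### Positivity, partial transposition, extendibility and witnesses -/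

/-- The partial transpose `X^{Γ_S}` on the tensor factors in `S`. -/
def partialTranspose {n d : ℕ} (S : Finset (Fin n)) (X : Op n d) : Op n d :=
  Matrix.of fun i j => X (fun a => if a ∈ S then j a else i a) (fun a => if a ∈ S then i a else j a)

/-- The set `[k]` of the first `k` tensor factors. -/
def firstFactors (n k : ℕ) : Finset (Fin n) := Finset.univ.filter fun a => a.val < k

/-- Positive semidefinite bosonic operators. -/
def PSD (n d : ℕ) : Set (Op n d) := {X | X ∈ HermBos n d ∧ X.PosSemidef}

/-- Bosonic operators `X` with `X^{Γ_[k]} ⪰ 0`. -/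
def PPTk (n k d : ℕ) : Set (Op n d) :=
  {X | X ∈ HermBos n d ∧ (partialTranspose (firstFactors n k) X).PosSemidef}

/-- Bosonic operators that are PPT across all bipartitions, `k = 0, …, ⌊n/2⌋`
(`k = 0` is positive semidefiniteness). -/
def PPT (n d : ℕ) : Set (Op n d) := {X | ∀ k ≤ n / 2, X ∈ PPTk n k d}

/-- The partial trace `Tr_[r]` over the first `r` of `r + n` tensor factors. -/
def partialTrace {n d : ℕ} (r : ℕ) (X : Op (r + n) d) : Op n d :=
  Matrix.of fun j j' => ∑ i : MIdx r d, X (Fin.append i j) (Fin.append i j')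

/-- `(n, r)`-bosonic extendible operators. -/
def BExt (n r d : ℕ) : Set (Op n d) :=
  {X | X ∈ HermBos n d ∧ ∃ Y ∈ PSD (r + n) d, partialTrace r Y = X}

/-- `(n, r)`-PPT bosonic extendible operators. -/
def PPTBExt (n r d : ℕ) : Set (Op n d) :=
  {X | X ∈ HermBos n d ∧ ∃ Y ∈ PPT (r + n) d, partialTrace r Y = X}

/-- The conic dual in `Herm[∨^n ℂ^d]` for the Hilbert–Schmidt inner product `Tr(X^* Y)`
(which is a real number for Hermitian `X`, `Y`). -/
def conicDual {n d : ℕ} (C : Set (Op n d)) : Set (Op n d) :=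
  {X | X ∈ HermBos n d ∧ ∀ Y ∈ C, 0 ≤ (Matrix.trace (Xᴴ * Y)).re}

/-- Bosonic-extendibility witnesses. -/
def ExtW (n r d : ℕ) : Set (Op n d) := conicDual (BExt n r d)

/-- PPT-extendibility witnesses. -/
def DecExtW (n r d : ℕ) : Set (Op n d) := conicDual (PPTBExt n r d)

/-! ### Real symmetric tensors and the two hierarchies -/

/-- Real tensors of order `n` and local dimension `d`. -/
abbrev RTensor (n d : ℕ) : Type := MIdx n d → ℝ

/-- The real symmetric tensors `∨^n ℝ^d`. -/
def SymTensor (n d : ℕ) : Set (RTensor n d) :=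
  {T | ∀ (σ : Equiv.Perm (Fin n)) (i : MIdx n d), T (i ∘ ⇑σ) = T i}

/-- A real tensor regarded as a complex tensor. -/
def toComplex {n d : ℕ} (T : RTensor n d) (i : MIdx n d) : ℂ := (T i : ℂ)

/-- The form `p_T(x) = ∑_i T_i x_{i_1} ⋯ x_{i_n}`. -/
noncomputable def tensorPoly {n d : ℕ} (T : RTensor n d) : MvPolynomial (Fin d) ℝ :=
  ∑ i : MIdx n d, MvPolynomial.C (T i) * ∏ k, MvPolynomial.X (i k)

/-- `χ_d^{(m)}`: forms of degree `m` in `d` variables with nonnegative coefficients. -/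
def NonnegForms (d m : ℕ) : Set (MvPolynomial (Fin d) ℝ) :=
  {p | p.IsHomogeneous m ∧ ∀ α, 0 ≤ p.coeff α}

/-- `Σ_d^{(2m)}`: finite sums of squares of forms of degree `m` in `d` variables. -/
def SOSForms (d m : ℕ) : Set (MvPolynomial (Fin d) ℝ) :=
  {p | ∃ (K : ℕ) (f : Fin K → MvPolynomial (Fin d) ℝ),
    (∀ k, (f k).IsHomogeneous m) ∧ p = ∑ k, f k ^ 2}

/-- Pólya's hierarchy: `p_T(x) (x_1 + ⋯ + x_d)^r` has nonnegative coefficients. -/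
def PNN (n r d : ℕ) : Set (RTensor n d) :=
  {T | T ∈ SymTensor n d ∧
    tensorPoly T * (∑ l : Fin d, MvPolynomial.X l) ^ r ∈ NonnegForms d (n + r)}

/-- Reznick's hierarchy: `p_T(x ⊙ x) ‖x‖^{2r}` is a sum of squares of forms of degree `n + r`.
Here `expand 2` is the substitution `x_l ↦ x_l^2`. -/
def RSOS (n r d : ℕ) : Set (RTensor n d) :=
  {T | T ∈ SymTensor n d ∧
    MvPolynomial.expand 2 (tensorPoly T) * (∑ l : Fin d, MvPolynomial.X l ^ 2) ^ r
      ∈ SOSForms d (n + r)}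

end Dicke

open Dicke

/-! Call the exponent vector `expo i` the type of the word `i`. An operator is bosonic exactly when
its entries depend only on the types of row and column (`symProj_sandwich_iff`); diagonal symmetry
further kills all entries between different types (`DS.apply_eq_zero`). So for a bosonic extension
`Y`, the pairing of `O` with its partial trace sees only the diagonal of `Y`: it equals Λ(p), where
p is the Pólya polynomial of `W[O]` and Λ sends x^β to the diagonal entry of `Y` at type β
(`DS.trace_re_eq`). Being a witness means Λ(p) ≥ 0 for all admissible `Y`.

For positive semidefinite `Y`, Λ has nonnegative weights, and the indicator of each single type
occurs, so the condition is nonnegativity of the coefficients of p.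

For PPT `Y`, the functionals Λ correspond to functionals L on forms that are nonnegative on squares,
via Λ(x^β) = L(x^(2β)). Such an L yields a PPT operator by the Schur product theorem
(`typeOp_mem_PPT`); conversely, the diagonal of a PPT operator, extended by zero to monomials with
an odd exponent, is nonnegative on squares (`monFun_evenMoment_sq_nonneg`). A form that is not a sum
of squares is separated from the squares by some L (`exists_functional_of_not_sos`), which closes
the argument. -/

namespace Dicke

/-! ### Words and their types -/

/-- The exponent vector of the word `i`, as a finitely supported function. -/
noncomputable def expo {n d : ℕ} (i : MIdx n d) : Fin d →₀ ℕ := ∑ k, Finsupp.single (i k) 1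

theorem expo_apply {n d : ℕ} (i : MIdx n d) (j : Fin d) : expo i j = occ i j := by
  rw [occ, Finset.card_filter, expo, Finsupp.finsetSum_apply]
  simp only [Finsupp.single_apply]

theorem coe_expo {n d : ℕ} (i : MIdx n d) : ⇑(expo i) = occ i := funext (expo_apply i)

theorem degree_expo {n d : ℕ} (i : MIdx n d) : (expo i).degree = n := by
  simp [expo]

theorem expo_append {r n d : ℕ} (i : MIdx r d) (j : MIdx n d) :
    expo (Fin.append i j) = expo i + expo j := by
  simp [expo, Fin.sum_univ_add]

theorem expo_comp_perm {n d : ℕ} (i : MIdx n d) (σ : Equiv.Perm (Fin n)) :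
    expo (i ∘ σ) = expo i := by
  simp only [expo, Function.comp]
  exact Equiv.sum_comp σ fun k => Finsupp.single (i k) 1

/-- Each letter occupies equally many positions in both words; bijections between these fibres glue
to a permutation. -/
theorem exists_perm_of_expo_eq {n d : ℕ} {i j : MIdx n d} (h : expo i = expo j) :
    ∃ σ : Equiv.Perm (Fin n), i = j ∘ σ := by
  have hc : ∀ c, Nonempty ({a // i a = c} ≃ {b // j b = c}) := fun c => by
    refine ⟨Fintype.equivOfCardEq ?_⟩
    have := DFunLike.congr_fun h c
    rw [expo_apply, expo_apply] at this
    simpa [occ, Fintype.card_subtype] using this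
  have e := fun c => (hc c).some
  exact ⟨Equiv.ofFiberEquiv e, funext fun a => (Equiv.ofFiberEquiv_map e a).symm⟩

theorem exists_expo_eq {d : ℕ} (n : ℕ) (β : Fin d →₀ ℕ) (h : β.degree = n) :
    ∃ i : MIdx n d, expo i = β := by
  induction n generalizing β with
  | zero =>
    refine ⟨Fin.elim0, ?_⟩
    rw [Finsupp.degree_eq_zero_iff] at h
    simp [expo, h]
  | succ n ih =>
    have hβ : β ≠ 0 := by rintro rfl; simp at h
    obtain ⟨j, hj⟩ := Finsupp.ne_iff.1 hβ
    have hle : Finsupp.single j 1 ≤ β := by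
      rw [Finsupp.single_le_iff]; simp at hj; omega
    obtain ⟨γ, rfl⟩ := exists_add_of_le hle
    obtain ⟨i, hi⟩ := ih γ (by simp at h; omega)
    exact ⟨Fin.cons j i, by simp [expo, Fin.sum_univ_succ] at hi ⊢; exact hi⟩

theorem prod_X_word {n d : ℕ} (i : MIdx n d) :
    ∏ k, (MvPolynomial.X (i k) : MvPolynomial (Fin d) ℝ) = MvPolynomial.monomial (expo i) 1 := by
  rw [expo, MvPolynomial.monomial_sum_one]; rfl

/-- Compare the coefficient of one monomial in (x_1 + ⋯ + x_d)^n, expanded over words and by the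
multinomial theorem. -/
theorem card_expo_eq {n d : ℕ} (j : MIdx n d) :
    (Finset.univ.filter fun i : MIdx n d => expo i = expo j).card
      = Nat.multinomial Finset.univ (occ j) := by
  have h := Finset.sum_pow_eq_sum_piAntidiag (R := MvPolynomial (Fin d) ℝ) Finset.univ
    MvPolynomial.X n
  rw [Fintype.sum_pow] at h
  have h2 := congrArg (MvPolynomial.coeff (expo j)) h
  simp only [prod_X_word, MvPolynomial.coeff_sum, MvPolynomial.coeff_monomial] at h2
  rw [Finset.sum_boole] at h2
  rw [Finset.sum_eq_single (occ j)] at h2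
  · have : ∏ i, (MvPolynomial.X i : MvPolynomial (Fin d) ℝ) ^ occ j i
        = MvPolynomial.monomial (expo j) 1 := by
      rw [MvPolynomial.monomial_eq, Finsupp.prod_fintype _ _ (by simp)]
      simp [expo_apply]
    rw [this, ← MvPolynomial.C_eq_coe_nat, MvPolynomial.coeff_C_mul,
      MvPolynomial.coeff_monomial] at h2
    simpa using h2
  · intro k hk hne
    have : ∏ i, (MvPolynomial.X i : MvPolynomial (Fin d) ℝ) ^ k i
        = MvPolynomial.monomial (Finsupp.equivFunOnFinite.symm k) 1 := by
      rw [MvPolynomial.monomial_eq, Finsupp.prod_fintype _ _ (by simp)]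
      simp
    rw [this, ← MvPolynomial.C_eq_coe_nat, MvPolynomial.coeff_C_mul,
      MvPolynomial.coeff_monomial, if_neg, mul_zero]
    rintro h
    apply hne
    rw [← coe_expo, ← h]
    rfl
  · intro hn
    exfalso; apply hn
    rw [Finset.mem_piAntidiag]
    refine ⟨?_, fun _ _ => Finset.mem_univ _⟩
    have := degree_expo j
    rw [Finsupp.degree_eq_sum] at this
    simpa [expo_apply] using this

/-! ### Bosonic operators -/

theorem permOp_mul_apply {n d : ℕ} (π : Equiv.Perm (Fin n)) (X : Op n d) (a b : MIdx n d) :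
    (permOp n d π * X) a b = X (a ∘ π) b := by
  rw [Matrix.mul_apply, Finset.sum_eq_single (a ∘ π)]
  · have : a = (a ∘ π) ∘ ⇑π⁻¹ := by ext; simp
    rw [permOp, Matrix.of_apply, if_pos this, one_mul]
  · intro c _ hc
    have : a ≠ c ∘ ⇑π⁻¹ := by
      rintro rfl; apply hc; ext; simp
    rw [permOp, Matrix.of_apply, if_neg this, zero_mul]
  · simp

theorem mul_permOp_apply {n d : ℕ} (π : Equiv.Perm (Fin n)) (X : Op n d) (a b : MIdx n d) :
    (X * permOp n d π) a b = X a (b ∘ ⇑π⁻¹) := by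
  simp [Matrix.mul_apply, permOp]

theorem symProj_mul_apply {n d : ℕ} (X : Op n d) (a b : MIdx n d) :
    (symProj n d * X) a b
      = (1 / (n.factorial : ℂ)) * ∑ π : Equiv.Perm (Fin n), X (a ∘ π) b := by
  simp [symProj, Finset.sum_mul, Matrix.sum_apply, permOp_mul_apply]

theorem mul_symProj_apply {n d : ℕ} (X : Op n d) (a b : MIdx n d) :
    (X * symProj n d) a b
      = (1 / (n.factorial : ℂ)) * ∑ π : Equiv.Perm (Fin n), X a (b ∘ ⇑π⁻¹) := by
  simp [symProj, Finset.mul_sum, Matrix.sum_apply, mul_permOp_apply]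

theorem symProj_mul_apply_perm {n d : ℕ} (X : Op n d) (σ : Equiv.Perm (Fin n)) (a b : MIdx n d) :
    (symProj n d * X) (a ∘ σ) b = (symProj n d * X) a b := by
  rw [symProj_mul_apply, symProj_mul_apply]
  congr 1
  exact Equiv.sum_comp (Equiv.mulLeft σ) fun π : Equiv.Perm (Fin n) => X (a ∘ π) b

theorem mul_symProj_apply_perm {n d : ℕ} (X : Op n d) (σ : Equiv.Perm (Fin n)) (a b : MIdx n d) :
    (X * symProj n d) a (b ∘ σ) = (X * symProj n d) a b := by
  rw [mul_symProj_apply, mul_symProj_apply]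
  congr 1
  exact Fintype.sum_equiv (Equiv.mulRight σ⁻¹) _ _ fun π => by simp [Function.comp_def]

/-- Multiplying by the projection averages rows or columns over permutations of the word, and the
orbits of words are the types. -/
theorem symProj_sandwich_iff {n d : ℕ} (X : Op n d) :
    symProj n d * X * symProj n d = X ↔
      ∀ i i' j j' : MIdx n d, expo i = expo i' → expo j = expo j' → X i j = X i' j' := by
  constructor
  · intro h i i' j j' hi hj
    obtain ⟨σ, rfl⟩ := exists_perm_of_expo_eq hi
    obtain ⟨τ, rfl⟩ := exists_perm_of_expo_eq hj
    rw [← h, mul_symProj_apply_perm, Matrix.mul_assoc, symProj_mul_apply_perm]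
  · intro h
    have hf : (n.factorial : ℂ) ≠ 0 := by exact_mod_cast n.factorial_ne_zero
    have h1 : symProj n d * X = X := by
      ext a b
      rw [symProj_mul_apply, Finset.sum_congr rfl fun (π : Equiv.Perm (Fin n)) _ =>
        h (a ∘ π) a b b (expo_comp_perm a π) rfl]
      simp [Fintype.card_perm, hf]
    rw [h1]
    ext a b
    rw [mul_symProj_apply, Finset.sum_congr rfl fun (π : Equiv.Perm (Fin n)) _ =>
      h a a (b ∘ ⇑π⁻¹) b rfl (expo_comp_perm b π⁻¹)]
    simp [Fintype.card_perm, hf]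

theorem partialTrace_mem_hermBos {n r d : ℕ} {Y : Op (r + n) d} (hY : Y ∈ HermBos (r + n) d) :
    partialTrace r Y ∈ HermBos n d := by
  obtain ⟨h1, h2⟩ := hY
  rw [symProj_sandwich_iff] at h2
  refine ⟨?_, (symProj_sandwich_iff _).2 ?_⟩
  · ext i j
    simp only [partialTrace, Matrix.conjTranspose_apply, Matrix.of_apply, star_sum]
    exact Finset.sum_congr rfl fun l _ => h1.apply _ _
  · intro i i' j j' hi hj
    simp only [partialTrace, Matrix.of_apply]
    exact Finset.sum_congr rfl fun l _ => h2 _ _ _ _ (by simp [expo_append, hi])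
      (by simp [expo_append, hj])

/-! ### Diagonally symmetric operators -/

/-- A nonzero entry forces equal phases of row and column. Rotating a single letter `l` by the angle
1/(n+1) separates all its multiplicities 0, …, n, since they differ by at most n < 2π(n+1). -/
theorem DS.apply_eq_zero {n d : ℕ} {X : Op n d} (hX : X ∈ DS n d) {i j : MIdx n d}
    (h : expo i ≠ expo j) : X i j = 0 := by
  obtain ⟨l, hl⟩ := DFunLike.ne_iff.1 h
  by_contra h0
  set t : ℝ := 1 / (n + 1) with ht
  have hdiag : tensorPow n (diagUnitary fun k => if k = l then t else 0)
      = Matrix.diagonal fun a : MIdx n d => Complex.exp (Complex.I * (t * (expo a l : ℂ))) := by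
    ext a b
    by_cases hab : a = b
    · subst hab
      have : ∀ k, diagUnitary (fun k => if k = l then t else 0) (a k) (a k)
          = Complex.exp (Complex.I * (t * if a k = l then 1 else 0)) := fun k => by
        by_cases hk : a k = l <;> simp [diagUnitary, hk]
      simp only [tensorPow, Matrix.of_apply, Matrix.diagonal_apply_eq, this, ← Complex.exp_sum,
        ← Finset.mul_sum]
      simp [expo_apply, occ]
    · obtain ⟨k, hk⟩ := Function.ne_iff.1 hab
      rw [Matrix.diagonal_apply_ne _ hab]
      exact Finset.prod_eq_zero (Finset.mem_univ k) (by simp [diagUnitary, hk])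
  have := congrFun (congrFun (hX.2 fun k => if k = l then t else 0) i) j
  rw [hdiag, Matrix.diagonal_mul, Matrix.mul_diagonal, mul_comm] at this
  obtain ⟨m, hm⟩ := Complex.exp_eq_exp_iff_exists_int.1 (mul_left_cancel₀ h0 this)
  have him := congrArg Complex.im hm
  simp at him
  have hi : expo i l ≤ n := (Finsupp.le_degree l (expo i)).trans_eq (degree_expo i)
  have hj : expo j l ≤ n := (Finsupp.le_degree l (expo j)).trans_eq (degree_expo j)
  have hn : (0 : ℝ) < n + 1 := by positivity
  have key : (expo i l : ℝ) - expo j l = (n + 1) * (m * (2 * Real.pi)) := by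
    rw [ht] at him; field_simp at him; linarith
  have hi' : (expo i l : ℝ) ≤ n := by exact_mod_cast hi
  have hj' : (expo j l : ℝ) ≤ n := by exact_mod_cast hj
  have hi0 : (0 : ℝ) ≤ expo i l := by positivity
  have hj0 : (0 : ℝ) ≤ expo j l := by positivity
  have hm0 : m = 0 := by
    by_contra hm0
    have h1 : (1 : ℝ) ≤ |(m : ℝ)| := by exact_mod_cast Int.one_le_abs hm0
    have h2 : |(expo i l : ℝ) - expo j l| ≤ n := abs_le.2 ⟨by linarith, by linarith⟩
    rw [key, abs_mul, abs_mul, abs_of_pos hn, abs_of_pos Real.two_pi_pos] at h2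
    have h3 : (1 : ℝ) ≤ |(m : ℝ)| * (2 * Real.pi) := by
      nlinarith [Real.pi_gt_three]
    nlinarith
  apply hl
  rw [hm0] at key
  have : (expo i l : ℝ) = expo j l := by simpa [sub_eq_zero] using key
  exact_mod_cast this

/-! ### Functionals on polynomials and the trace formula -/

/-- The linear functional on polynomials which maps the monomial `x^β` to `y β`. -/
noncomputable def monFun {d : ℕ} (y : (Fin d →₀ ℕ) → ℝ) : MvPolynomial (Fin d) ℝ →ₗ[ℝ] ℝ :=
  (MvPolynomial.basisMonomials (Fin d) ℝ).constr ℝ y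

theorem monFun_monomial {d : ℕ} (y : (Fin d →₀ ℕ) → ℝ) (β : Fin d →₀ ℕ) (c : ℝ) :
    monFun y (MvPolynomial.monomial β c) = c * y β := by
  have h : MvPolynomial.monomial β c
      = c • (MvPolynomial.basisMonomials (Fin d) ℝ) β := by
    simp [MvPolynomial.smul_monomial]
  rw [h, map_smul, monFun, Module.Basis.constr_basis, smul_eq_mul]

theorem monFun_eq_sum {d : ℕ} (y : (Fin d →₀ ℕ) → ℝ) (p : MvPolynomial (Fin d) ℝ) :
    monFun y p = ∑ β ∈ p.support, p.coeff β * y β := by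
  conv_lhs => rw [p.as_sum]
  rw [map_sum]
  exact Finset.sum_congr rfl fun β _ => monFun_monomial y β _

theorem coeff_eq_monFun {d : ℕ} (β : Fin d →₀ ℕ) (p : MvPolynomial (Fin d) ℝ) :
    p.coeff β = monFun (fun γ => if γ = β then 1 else 0) p := by
  rw [monFun_eq_sum]
  simp

theorem monFun_comp {d : ℕ} (L : MvPolynomial (Fin d) ℝ →ₗ[ℝ] ℝ) :
    monFun (fun β => L (MvPolynomial.monomial β 1)) = L := by
  refine (MvPolynomial.basisMonomials (Fin d) ℝ).ext fun β => ?_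
  simp [monFun_monomial]

theorem monFun_expand {d : ℕ} (y : (Fin d →₀ ℕ) → ℝ) (p : MvPolynomial (Fin d) ℝ) :
    monFun y (MvPolynomial.expand 2 p) = monFun (fun β => y (2 • β)) p := by
  conv_lhs => rw [p.as_sum]
  simp only [map_sum, MvPolynomial.expand_monomial, monFun_monomial]
  rw [monFun_eq_sum]

theorem polyaPoly_eq_sum {n d : ℕ} (T : RTensor n d) (r : ℕ) :
    tensorPoly T * (∑ l : Fin d, MvPolynomial.X l) ^ r
      = ∑ l : MIdx r d, ∑ j : MIdx n d, MvPolynomial.monomial (expo (Fin.append l j)) (T j) := by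
  rw [Fintype.sum_pow, tensorPoly, Finset.sum_mul_sum, Finset.sum_comm]
  refine Finset.sum_congr rfl fun l _ => Finset.sum_congr rfl fun j _ => ?_
  rw [prod_X_word, prod_X_word, MvPolynomial.C_mul_monomial, MvPolynomial.monomial_mul,
    expo_append, add_comm]
  simp

theorem expand_polyaPoly {n d : ℕ} (T : RTensor n d) (r : ℕ) :
    MvPolynomial.expand 2 (tensorPoly T) * (∑ l : Fin d, MvPolynomial.X l ^ 2) ^ r
      = MvPolynomial.expand 2 (tensorPoly T * (∑ l : Fin d, MvPolynomial.X l) ^ r) := by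
  simp [map_sum]

theorem monFun_polyaPoly {n d : ℕ} (T : RTensor n d) (r : ℕ) (y : (Fin d →₀ ℕ) → ℝ) :
    monFun y (tensorPoly T * (∑ l : Fin d, MvPolynomial.X l) ^ r)
      = ∑ l : MIdx r d, ∑ j : MIdx n d, T j * y (expo (Fin.append l j)) := by
  simp [polyaPoly_eq_sum, monFun_monomial]

theorem isHomogeneous_polyaPoly {n d : ℕ} (T : RTensor n d) (r : ℕ) :
    (tensorPoly T * (∑ l : Fin d, MvPolynomial.X l) ^ r).IsHomogeneous (n + r) := by
  rw [polyaPoly_eq_sum]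
  refine MvPolynomial.IsHomogeneous.sum _ _ _ fun l _ =>
    MvPolynomial.IsHomogeneous.sum _ _ _ fun j _ => ?_
  exact MvPolynomial.isHomogeneous_monomial _ (by rw [degree_expo, add_comm])

/-- The column is constant on the words of the type of `j` and zero elsewhere; counting those words
produces the multinomial factor of `wTensor`. -/
theorem DS.sum_column {n d : ℕ} {O : Op n d} (hO : O ∈ DS n d) (j : MIdx n d)
    (f : (Fin d →₀ ℕ) → ℂ) :
    ∑ i, star (O i j) * f (expo i) = star (wTensor O j) * f (expo j) := by
  have h1 : ∀ i, star (O i j) * f (expo i)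
      = if expo i = expo j then star (O j j) * f (expo j) else 0 := fun i => by
    split_ifs with h
    · rw [(symProj_sandwich_iff O).1 hO.1 i j j j h rfl, h]
    · rw [DS.apply_eq_zero hO h, star_zero, zero_mul]
  rw [Finset.sum_congr rfl fun i _ => h1 i]
  rw [← Finset.sum_filter, Finset.sum_const, card_expo_eq, wTensor, nsmul_eq_mul,
    star_mul', star_natCast]
  ring

theorem DS.trace_eq {n r d : ℕ} {O : Op n d} (hO : O ∈ DS n d) {Y : Op (r + n) d}
    (hY : Y ∈ HermBos (r + n) d) :
    (Oᴴ * partialTrace r Y).trace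
      = ∑ l : MIdx r d, ∑ j : MIdx n d,
          star (wTensor O j) * Y (Fin.append l j) (Fin.append l j) := by
  have hb := (symProj_sandwich_iff Y).1 hY.2
  rw [Finset.sum_comm, Matrix.trace]
  refine Finset.sum_congr rfl fun j _ => ?_
  rw [Matrix.diag_apply, Matrix.mul_apply]
  simp only [Matrix.conjTranspose_apply, partialTrace, Matrix.of_apply, Finset.mul_sum]
  rw [Finset.sum_comm]
  refine Finset.sum_congr rfl fun l _ => ?_
  have h := DS.sum_column hO j fun β => if β = expo j then
    Y (Fin.append l j) (Fin.append l j) else 0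
  rw [if_pos rfl] at h
  rw [← h]
  refine Finset.sum_congr rfl fun i _ => ?_
  split_ifs with hij
  · rw [hb _ (Fin.append l j) _ (Fin.append l j) (by simp [expo_append, hij]) rfl]
  · rw [mul_zero, DS.apply_eq_zero hO hij, star_zero, zero_mul]

theorem DS.trace_re_eq {n r d : ℕ} {O : Op n d} (hO : O ∈ DS n d) {T : RTensor n d}
    (hT : toComplex T = wTensor O) {Y : Op (r + n) d} (hY : Y ∈ HermBos (r + n) d)
    {y : (Fin d →₀ ℕ) → ℝ} (hy : ∀ a, (Y a a).re = y (expo a)) :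
    (Oᴴ * partialTrace r Y).trace.re
      = monFun y (tensorPoly T * (∑ l : Fin d, MvPolynomial.X l) ^ r) := by
  rw [DS.trace_eq hO hY, monFun_polyaPoly, Complex.re_sum]
  refine Finset.sum_congr rfl fun l _ => ?_
  rw [Complex.re_sum]
  refine Finset.sum_congr rfl fun j _ => ?_
  rw [← hT, ← hy]
  simp [toComplex]

/-- Every nonzero entry repeats a diagonal one, so Hermiticity is reality of the diagonal; the
multinomial factor is a nonzero real. -/
theorem DS.mem_hermBos_iff {n d : ℕ} {O : Op n d} (hO : O ∈ DS n d) :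
    O ∈ HermBos n d ↔ ∃ T ∈ SymTensor n d, toComplex T = wTensor O := by
  have hb := (symProj_sandwich_iff O).1 hO.1
  constructor
  · intro h
    refine ⟨fun i => (wTensor O i).re, ?_, ?_⟩
    · intro σ i
      have he := expo_comp_perm i σ
      simp only [wTensor]
      rw [hb _ i _ i he he, ← coe_expo, ← coe_expo, he]
    · ext i
      have : (O i i).im = 0 := Complex.conj_eq_iff_im.1 (h.1.apply i i)
      apply Complex.ext <;> simp [toComplex, wTensor, this]
  · rintro ⟨T, -, hT⟩
    refine ⟨?_, hO.1⟩
    ext i j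
    rw [Matrix.conjTranspose_apply]
    by_cases hij : expo i = expo j
    · rw [hb j i i i hij.symm rfl, hb i i j i rfl hij.symm]
      have h1 := congrFun hT i
      have hm : (Nat.multinomial Finset.univ (occ i) : ℝ) ≠ 0 := by
        exact_mod_cast (Nat.multinomial_pos _ _).ne'
      have h2 := congrArg Complex.im h1
      simp [toComplex, wTensor] at h2
      refine Complex.conj_eq_iff_im.2 ?_
      rcases h2 with h2 | h2
      · exact h2
      · exact absurd (by exact_mod_cast h2) hm
    · rw [DS.apply_eq_zero hO hij, DS.apply_eq_zero hO (Ne.symm hij), star_zero]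

/-! ### Bosonic operators with prescribed diagonal -/

/-- The operator whose only nonzero entries are `y β` at all pairs of words of type `β`. -/
noncomputable def typeOp (n : ℕ) {d : ℕ} (y : (Fin d →₀ ℕ) → ℝ) : Op n d :=
  Matrix.of fun a b => if expo a = expo b then (y (expo a) : ℂ) else 0

theorem typeOp_mem_hermBos (n : ℕ) {d : ℕ} (y : (Fin d →₀ ℕ) → ℝ) :
    typeOp n y ∈ HermBos n d := by
  refine ⟨?_, (symProj_sandwich_iff _).2 fun i i' j j' hi hj => by simp [typeOp, hi, hj]⟩
  ext a b
  rw [Matrix.conjTranspose_apply, typeOp, Matrix.of_apply, Matrix.of_apply]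
  by_cases h : expo a = expo b
  · simp [h]
  · simp [h, Ne.symm h]

theorem typeOp_indicator_posSemidef (n : ℕ) {d : ℕ} (β : Fin d →₀ ℕ) :
    (typeOp n fun γ => if γ = β then 1 else 0).PosSemidef := by
  convert Matrix.posSemidef_vecMulVec_self_star
    (fun a : MIdx n d => if expo a = β then (1 : ℂ) else 0) using 1
  ext a b
  simp only [typeOp, Matrix.of_apply, Matrix.vecMulVec_apply, Pi.star_apply]
  by_cases ha : expo a = β <;> by_cases hb : expo b = β
  · simp [ha, hb]
  · simp [ha, hb, Ne.symm hb]
  · simp [ha]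
  · simp [ha]

/-- The diagonal of a bosonic operator as a function of the type. -/
noncomputable def typeDiag {n d : ℕ} (Y : Op n d) (β : Fin d →₀ ℕ) : ℝ :=
  -- The default 0 keeps the function nonnegative at all exponents when `Y` is positive
  -- semidefinite.
  open Classical in if h : ∃ a : MIdx n d, expo a = β then (Y h.choose h.choose).re else 0

theorem typeDiag_expo {n d : ℕ} {Y : Op n d} (hY : Y ∈ HermBos n d) (a : MIdx n d) :
    (Y a a).re = typeDiag Y (expo a) := by
  have h : ∃ b : MIdx n d, expo b = expo a := ⟨a, rfl⟩
  rw [typeDiag, dif_pos h, (symProj_sandwich_iff Y).1 hY.2 _ _ _ _ h.choose_spec h.choose_spec]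

theorem typeDiag_nonneg {n d : ℕ} {Y : Op n d} (hY : Y.PosSemidef) (β : Fin d →₀ ℕ) :
    0 ≤ typeDiag Y β := by
  rw [typeDiag]
  split_ifs with h
  · exact (Complex.le_def.1 hY.diag_nonneg).1
  · exact le_rfl

/-! ### The bosonic case -/

theorem mem_conicDual_iff {n r d : ℕ} {O : Op n d} (hO : O ∈ DS n d) (P : Set (Op (r + n) d))
    (hP : P ⊆ HermBos (r + n) d) :
    O ∈ conicDual {X | X ∈ HermBos n d ∧ ∃ Y ∈ P, partialTrace r Y = X} ↔
      ∃ T ∈ SymTensor n d, toComplex T = wTensor O ∧ ∀ Y ∈ P,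
        0 ≤ monFun (typeDiag Y) (tensorPoly T * (∑ l : Fin d, MvPolynomial.X l) ^ r) := by
  constructor
  · rintro ⟨h1, h2⟩
    obtain ⟨T, hTs, hT⟩ := (DS.mem_hermBos_iff hO).1 h1
    refine ⟨T, hTs, hT, fun Y hY => ?_⟩
    rw [← DS.trace_re_eq hO hT (hP hY) (typeDiag_expo (hP hY))]
    exact h2 _ ⟨partialTrace_mem_hermBos (hP hY), Y, hY, rfl⟩
  · rintro ⟨T, hTs, hT, h⟩
    refine ⟨(DS.mem_hermBos_iff hO).2 ⟨T, hTs, hT⟩, ?_⟩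
    rintro _ ⟨-, Y, hY, rfl⟩
    rw [DS.trace_re_eq hO hT (hP hY) (typeDiag_expo (hP hY))]
    exact h Y hY

theorem monFun_congr {m d : ℕ} {y z : (Fin d →₀ ℕ) → ℝ} {p : MvPolynomial (Fin d) ℝ}
    (hp : p.IsHomogeneous m) (h : ∀ a : MIdx m d, y (expo a) = z (expo a)) :
    monFun y p = monFun z p := by
  rw [monFun_eq_sum, monFun_eq_sum]
  refine Finset.sum_congr rfl fun β hβ => ?_
  have hd : β.degree = m := by
    rw [Finsupp.degree_eq_weight_one]
    exact hp (MvPolynomial.mem_support_iff.1 hβ)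
  obtain ⟨a, rfl⟩ := exists_expo_eq m β hd
  rw [h]

theorem typeDiag_typeOp {n d : ℕ} (y : (Fin d →₀ ℕ) → ℝ) (a : MIdx n d) :
    typeDiag (typeOp n y) (expo a) = y (expo a) := by
  rw [← typeDiag_expo (typeOp_mem_hermBos n y)]
  simp [typeOp]

/-- The extension supported on one type reads off one coefficient; any other extension gives a
nonnegative combination of coefficients. -/
theorem mem_extW_iff {n r d : ℕ} {O : Op n d} (hO : O ∈ DS n d) :
    O ∈ ExtW n r d ↔ wTensor O ∈ toComplex '' PNN n r d := by
  rw [ExtW, BExt, mem_conicDual_iff hO _ fun Y hY => hY.1]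
  constructor
  · rintro ⟨T, hTs, hT, h⟩
    refine ⟨T, ⟨hTs, isHomogeneous_polyaPoly T r, fun β => ?_⟩, hT⟩
    have := h (typeOp (r + n) fun γ => if γ = β then 1 else 0)
      ⟨typeOp_mem_hermBos _ _, typeOp_indicator_posSemidef _ β⟩
    rw [monFun_congr (add_comm n r ▸ isHomogeneous_polyaPoly T r) (typeDiag_typeOp _)] at this
    rwa [coeff_eq_monFun]
  · rintro ⟨T, ⟨hTs, -, h⟩, hT⟩
    refine ⟨T, hTs, hT, fun Y hY => ?_⟩
    rw [monFun_eq_sum]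
    exact Finset.sum_nonneg fun β _ => mul_nonneg (h β) (typeDiag_nonneg hY.2 β)

/-! ### Separation from the cone spanned by a positive definite quadratic map -/

section Separation

variable {ι E : Type*} [Fintype ι] [NormedAddCommGroup E] [NormedSpace ℝ E]

/-- The sum over the rows `v` of `B` of the quadratic expressions `∑ v_a v_b Q_{ab}`. -/
def gramSum (Q : ι → ι → E) (B : Matrix ι ι ℝ) : E :=
  ∑ k, ∑ a, ∑ b, (B k a * B k b) • Q a b

theorem gramSum_eq (Q : ι → ι → E) (B : Matrix ι ι ℝ) :
    gramSum Q B = ∑ a, ∑ b, (Bᵀ * B) a b • Q a b := by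
  rw [gramSum, Finset.sum_comm]
  refine Finset.sum_congr rfl fun a _ => ?_
  rw [Finset.sum_comm]
  refine Finset.sum_congr rfl fun b _ => ?_
  rw [← Finset.sum_smul]
  rfl

theorem trace_transpose_mul_self_eq (B : Matrix ι ι ℝ) :
    (Bᵀ * B).trace = ∑ k, ∑ a, B k a ^ 2 := by
  rw [Finset.sum_comm]
  simp [Matrix.trace, Matrix.mul_apply, pow_two]

theorem isCompact_gramSum_sphere (Q : ι → ι → E) :
    IsCompact (gramSum Q '' {B | ∑ k, ∑ a, B k a ^ 2 = 1}) := by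
  refine IsCompact.image ?_ ?_
  · have hB : IsCompact (Set.pi Set.univ fun _ : ι => Set.pi Set.univ fun _ : ι =>
        Set.Icc (-1 : ℝ) 1) :=
      isCompact_univ_pi fun _ => isCompact_univ_pi fun _ => isCompact_Icc
    refine IsCompact.of_isClosed_subset (X := ι → ι → ℝ) hB ?_ ?_
    · exact isClosed_eq (by fun_prop) continuous_const
    · intro B hB k _ a _
      have h1 : B k a ^ 2 ≤ ∑ k, ∑ a, B k a ^ 2 :=
        (Finset.single_le_sum (f := fun a => B k a ^ 2) (fun _ _ => sq_nonneg _)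
          (Finset.mem_univ a)).trans
        (Finset.single_le_sum (f := fun k => ∑ a, B k a ^ 2)
          (fun _ _ => Finset.sum_nonneg fun _ _ => sq_nonneg _) (Finset.mem_univ k))
      rw [hB] at h1
      exact abs_le.1 ((sq_le_one_iff_abs_le_one _).1 h1)
  · unfold gramSum
    have h : ∀ k a, Continuous fun B : Matrix ι ι ℝ => B k a := fun k a =>
      (continuous_apply a).comp (continuous_apply k)
    exact continuous_finsetSum _ fun k _ => continuous_finsetSum _ fun a _ =>
      continuous_finsetSum _ fun b _ => ((h k a).mul (h k b)).smul continuous_const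

-- `gramSum` depends on `B` only through `Bᵀ * B`, and a convex combination of positive semidefinite
-- matrices of trace one is again such a Gram matrix, with a square factor.
open scoped MatrixOrder in
theorem convex_gramSum_sphere (Q : ι → ι → E) :
    Convex ℝ (gramSum Q '' {B | ∑ k, ∑ a, B k a ^ 2 = 1}) := by
  classical
  rintro _ ⟨B, hB, rfl⟩ _ ⟨C, hC, rfl⟩ s t hs ht hst
  have hps : (s • (Bᵀ * B) + t • (Cᵀ * C)).PosSemidef :=
    ((Matrix.posSemidef_conjTranspose_mul_self B).smul hs).add
      ((Matrix.posSemidef_conjTranspose_mul_self C).smul ht)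
  obtain ⟨D, hD⟩ := CStarAlgebra.nonneg_iff_eq_star_mul_self.1 hps.nonneg
  rw [Matrix.star_eq_conjTranspose, Matrix.conjTranspose_eq_transpose_of_trivial] at hD
  refine ⟨D, ?_, ?_⟩
  · rw [Set.mem_ofPred_eq, ← trace_transpose_mul_self_eq] at *
    rw [← hD, Matrix.trace_add, Matrix.trace_smul, Matrix.trace_smul, hB, hC]
    simpa using hst
  · rw [gramSum_eq, gramSum_eq, gramSum_eq, ← hD]
    simp [add_smul, mul_smul, Finset.sum_add_distrib, Finset.smul_sum]

/-- If the quadratic map `v ↦ ∑ v_a v_b Q_{ab}` is positive definite for some functional, then a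
vector which is not a finite sum of its values is separated from them by a functional. -/
theorem exists_gramSum_eq_or_separated (Q : ι → ι → E) (L₀ : E →L[ℝ] ℝ)
    (hL₀ : ∀ v : ι → ℝ, v ≠ 0 → 0 < L₀ (∑ a, ∑ b, (v a * v b) • Q a b)) (q : E) :
    (∃ B, gramSum Q B = q) ∨
      ∃ L : E →L[ℝ] ℝ, (∀ v : ι → ℝ, 0 ≤ L (∑ a, ∑ b, (v a * v b) • Q a b)) ∧ L q < 0 := by
  classical
  refine or_iff_not_imp_left.2 fun hq => ?_
  have hq0 : q ≠ 0 := by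
    rintro rfl
    exact hq ⟨0, by simp [gramSum]⟩
  set K := gramSum Q '' {B | ∑ k, ∑ a, B k a ^ 2 = 1} with hK
  have hKc : IsCompact K := isCompact_gramSum_sphere Q
  set R : Set E := (fun t : ℝ => t • q) '' Set.Ici 0 with hR
  have hRconv : Convex ℝ R := (convex_Ici 0).linear_image (LinearMap.toSpanSingleton ℝ E q)
  have hRcl : IsClosed R :=
    (isClosedEmbedding_smul_left hq0).isClosedMap _ isClosed_Ici
  -- Positive definiteness keeps 0 out of the compact base `K`, so `K` can only meet the ray `R` at
  -- a positive multiple of `q`.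
  have hpos : ∀ e ∈ K, 0 < L₀ e := by
    rintro _ ⟨B, hB, rfl⟩
    rw [gramSum, map_sum]
    have hrow : ∀ k, 0 ≤ L₀ (∑ a, ∑ b, (B k a * B k b) • Q a b) := fun k => by
      by_cases hk : B k = 0
      · simp [hk]
      · exact (hL₀ _ hk).le
    refine (Finset.sum_nonneg fun k _ => hrow k).lt_of_ne fun h0 => ?_
    rw [eq_comm, Finset.sum_eq_zero_iff_of_nonneg fun k _ => hrow k] at h0
    have hB0 : ∀ k, B k = 0 := fun k => by
      by_contra hk
      exact (hL₀ _ hk).ne' (h0 k (Finset.mem_univ k))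
    simp [hB0] at hB
  have hdisj : Disjoint K R := by
    rw [Set.disjoint_left]
    rintro e he ⟨t, ht, rfl⟩
    have ht0 : t ≠ 0 := by
      rintro rfl
      simpa using hpos _ he
    obtain ⟨B, -, hB⟩ := he
    refine hq ⟨Real.sqrt t⁻¹ • B, ?_⟩
    have : gramSum Q (Real.sqrt t⁻¹ • B) = t⁻¹ • gramSum Q B := by
      rw [gramSum_eq, gramSum_eq, Matrix.transpose_smul, Matrix.smul_mul, Matrix.mul_smul,
        smul_smul, Real.mul_self_sqrt (inv_nonneg.2 ht)]
      simp [Finset.smul_sum, mul_smul]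
    rw [this, hB]
    simp [smul_smul, ht0]
  obtain ⟨f, u, v, hfu, huv, hfv⟩ :=
    geometric_hahn_banach_compact_closed (convex_gramSum_sphere Q) hKc hRconv hRcl hdisj
  have hv0 : v < 0 := by simpa using hfv 0 ⟨0, by simp, by simp⟩
  -- Otherwise `f` would attain the value `v` on the ray.
  have hfq : 0 ≤ f q := by
    by_contra! h
    have := hfv ((v / f q) • q) ⟨v / f q, div_nonneg_of_nonpos hv0.le h.le, rfl⟩
    simp [h.ne] at this
  obtain ⟨M, hM⟩ := SeparatingDual.exists_eq_one (R := ℝ) hq0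
  obtain ⟨b, hb⟩ := (hKc.image M.continuous).isBounded.exists_norm_le
  -- `f q` may vanish, so `-f` is tilted by a functional `M` with `M q = 1`. The factor is small
  -- enough that `c * M ≤ -u` on `K`, where `-f > -u`.
  set c : ℝ := -u / (|b| + 1) with hc
  have hu : u < 0 := huv.trans hv0
  have hb1 : 0 < |b| + 1 := by positivity
  have hc0 : 0 < c := div_pos (by linarith) hb1
  refine ⟨-f - c • M, fun w => ?_, ?_⟩
  · by_cases hw : w = 0
    · simp [hw]
    -- rescale `w` to unit length, and use the matrix whose only nonzero row is `w`
    have hne : Nonempty ι := by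
      by_contra h
      rw [not_nonempty_iff] at h
      exact hw (Subsingleton.elim _ _)
    obtain ⟨k₀⟩ := hne
    have hs : 0 < ∑ a, w a ^ 2 := by
      obtain ⟨a, ha⟩ := Function.ne_iff.1 hw
      exact Finset.sum_pos' (fun _ _ => sq_nonneg _) ⟨a, Finset.mem_univ a, by
        have : w a ≠ 0 := ha
        positivity⟩
    set s := ∑ a, w a ^ 2
    set B : Matrix ι ι ℝ := Matrix.of fun k a => if k = k₀ then Real.sqrt s⁻¹ * w a else 0
      with hBdef
    have hss : Real.sqrt s⁻¹ ^ 2 = s⁻¹ := Real.sq_sqrt (inv_nonneg.2 hs.le)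
    have hBK : gramSum Q B ∈ K := by
      refine ⟨B, ?_, rfl⟩
      have : ∀ k, ∑ a, B k a ^ 2 = if k = k₀ then 1 else 0 := fun k => by
        by_cases hk : k = k₀
        · simp only [hBdef, Matrix.of_apply, hk, if_true, mul_pow, hss, ← Finset.mul_sum]
          exact inv_mul_cancel₀ hs.ne'
        · simp [hBdef, hk]
      simp only [Set.mem_ofPred_eq, this, Finset.sum_ite_eq', Finset.mem_univ, if_true]
    have hBe : gramSum Q B = s⁻¹ • ∑ a, ∑ b, (w a * w b) • Q a b := by
      rw [gramSum, Finset.sum_eq_single k₀]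
      · simp only [hBdef, Matrix.of_apply, if_true, Finset.smul_sum, smul_smul]
        refine Finset.sum_congr rfl fun a _ => Finset.sum_congr rfl fun b _ => ?_
        congr 1
        linear_combination (w a * w b) * hss
      · intro k _ hk
        simp only [hBdef, Matrix.of_apply, if_neg hk, zero_mul, zero_smul, Finset.sum_const_zero]
      · simp
    have h1 := hfu _ hBK
    have h2 := (hb _ (Set.mem_image_of_mem M hBK))
    have h3 : c * M (gramSum Q B) ≤ -u := by
      have : M (gramSum Q B) ≤ |b| + 1 := by
        rw [Real.norm_eq_abs] at h2
        linarith [le_abs_self (M (gramSum Q B)), le_abs_self b]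
      calc c * M (gramSum Q B) ≤ c * (|b| + 1) := by gcongr
        _ = -u := by rw [hc]; field_simp
    have h4 : 0 ≤ (-f - c • M) (gramSum Q B) := by
      simp only [sub_apply, neg_apply,
        smul_apply, smul_eq_mul]
      linarith
    rw [hBe, map_smul, smul_eq_mul] at h4
    exact nonneg_of_mul_nonneg_right h4 (inv_pos.2 hs)
  · simp [hM]
    linarith

end Separation

/-! ### Sums of squares -/

/-- The exponents of degree `m`. -/
abbrev Exps (d m : ℕ) : Type := {α : Fin d →₀ ℕ // α ∈ Finset.finsuppAntidiag Finset.univ m}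

theorem mem_exps_iff {d m : ℕ} (α : Fin d →₀ ℕ) :
    α ∈ Finset.finsuppAntidiag Finset.univ m ↔ α.degree = m := by
  simp [Finset.mem_finsuppAntidiag, Finsupp.degree_eq_sum]

/-- The form of degree `m` with coefficients `v`. -/
noncomputable def formOf {d m : ℕ} (v : Exps d m → ℝ) : MvPolynomial (Fin d) ℝ :=
  ∑ α : Exps d m, MvPolynomial.monomial α.1 (v α)

theorem formOf_isHomogeneous {d m : ℕ} (v : Exps d m → ℝ) : (formOf v).IsHomogeneous m :=
  MvPolynomial.IsHomogeneous.sum _ _ _ fun α _ =>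
    MvPolynomial.isHomogeneous_monomial _ ((mem_exps_iff α.1).1 α.2)

theorem coeff_formOf {d m : ℕ} (v : Exps d m → ℝ) (α : Exps d m) :
    (formOf v).coeff α.1 = v α := by
  simp [formOf, MvPolynomial.coeff_sum, MvPolynomial.coeff_monomial]

theorem formOf_coeff {d m : ℕ} {p : MvPolynomial (Fin d) ℝ} (hp : p.IsHomogeneous m) :
    formOf (fun α : Exps d m => p.coeff α.1) = p := by
  ext β
  by_cases h : β ∈ Finset.finsuppAntidiag Finset.univ m
  · exact coeff_formOf _ (⟨β, h⟩ : Exps d m)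
  · rw [mem_exps_iff, Finsupp.degree_eq_weight_one] at h
    rw [hp.coeff_eq_zero, (formOf_isHomogeneous _).coeff_eq_zero] <;>
    · rwa [Finsupp.degree_eq_weight_one]

theorem formOf_sq {d m : ℕ} (v : Exps d m → ℝ) :
    formOf v ^ 2 = ∑ α, ∑ β, (v α * v β) • MvPolynomial.monomial (α.1 + β.1) (1 : ℝ) := by
  simp [pow_two, formOf, Finset.sum_mul_sum, MvPolynomial.monomial_mul,
    MvPolynomial.smul_monomial]

/-- The linear map sending a vector of coefficients of degree `m` to its form. -/
noncomputable def formLin (d m : ℕ) : (Exps d m → ℝ) →ₗ[ℝ] MvPolynomial (Fin d) ℝ where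
  toFun := formOf
  map_add' v w := by simp [formOf, Finset.sum_add_distrib]
  map_smul' c v := by simp [formOf, Finset.smul_sum, MvPolynomial.smul_monomial]

/-- On the grid {0, …, m}^d no nonzero form of degree m vanishes identically, as its degree in each
variable is at most m. This supplies the positive definite functional for the separation. -/
theorem exists_sum_eval_sq_pos (d m : ℕ) : ∃ S : Finset (Fin d → ℝ),
    ∀ p : MvPolynomial (Fin d) ℝ, p.IsHomogeneous m → p ≠ 0 →
      0 < ∑ x ∈ S, MvPolynomial.eval x (p ^ 2) := by
  classical
  set G : Finset ℝ := (Finset.range (m + 1)).image (fun k : ℕ => (k : ℝ)) with hG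
  have hcard : G.card = m + 1 := by
    rw [hG, Finset.card_image_of_injective _ Nat.cast_injective, Finset.card_range]
  refine ⟨Fintype.piFinset fun _ => G, fun p hp hp0 => ?_⟩
  simp only [map_pow]
  refine (Finset.sum_nonneg fun _ _ => sq_nonneg _).lt_of_ne fun h => hp0 ?_
  rw [eq_comm, Finset.sum_eq_zero_iff_of_nonneg fun _ _ => sq_nonneg _] at h
  refine MvPolynomial.eq_zero_of_eval_zero_at_prod_finset p (fun _ => G) (fun i => ?_) fun x hx =>
    pow_eq_zero_iff two_ne_zero |>.1 (h x (Fintype.mem_piFinset.2 hx))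
  rw [hcard, Nat.lt_succ_iff]
  exact (MvPolynomial.degreeOf_le_totalDegree p i).trans hp.totalDegree_le

/-- A form of degree `2m` which is not a sum of squares of forms is separated from the squares. -/
theorem exists_functional_of_not_sos {d m : ℕ} {q : MvPolynomial (Fin d) ℝ}
    (hq : q.IsHomogeneous (m + m)) (h : q ∉ SOSForms d m) :
    ∃ L : MvPolynomial (Fin d) ℝ →ₗ[ℝ] ℝ,
      (∀ p : MvPolynomial (Fin d) ℝ, p.IsHomogeneous m → 0 ≤ L (p ^ 2)) ∧ L q < 0 := by
  -- Separation takes place in the finite-dimensional space of coefficient vectors; on forms of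
  -- degree 2m, `Φ` is inverted by `formLin`.
  set E := Exps d (m + m) → ℝ
  let Φ : MvPolynomial (Fin d) ℝ →ₗ[ℝ] E := LinearMap.pi fun α => MvPolynomial.lcoeff ℝ α.1
  have hΦ : ∀ p : MvPolynomial (Fin d) ℝ, p.IsHomogeneous (m + m) → formLin d (m + m) (Φ p) = p :=
    fun p hp => formOf_coeff hp
  have hsq : ∀ v : Exps d m → ℝ, (formOf v ^ 2).IsHomogeneous (m + m) := fun v => by
    rw [pow_two]; exact (formOf_isHomogeneous v).mul (formOf_isHomogeneous v)
  let Q : Exps d m → Exps d m → E := fun α β => Φ (MvPolynomial.monomial (α.1 + β.1) 1)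
  have hQ : ∀ v : Exps d m → ℝ, ∑ a, ∑ b, (v a * v b) • Q a b = Φ (formOf v ^ 2) := fun v => by
    simp only [formOf_sq, map_sum, map_smul, Q]
  obtain ⟨S, hS⟩ := exists_sum_eval_sq_pos d m
  let L₀ : E →ₗ[ℝ] ℝ :=
    (∑ x ∈ S, (MvPolynomial.aeval (R := ℝ) x).toLinearMap) ∘ₗ formLin d (m + m)
  have hL₀ : ∀ v : Exps d m → ℝ, v ≠ 0 →
      0 < L₀.toContinuousLinearMap (∑ a, ∑ b, (v a * v b) • Q a b) := fun v hv => by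
    have h0 : formOf v ≠ 0 := fun h0 => hv (funext fun α => by
      rw [← coeff_formOf v α, h0]; simp)
    have := hS _ (formOf_isHomogeneous v) h0
    rw [hQ, LinearMap.coe_toContinuousLinearMap']
    simp only [L₀, LinearMap.comp_apply, hΦ _ (hsq v), LinearMap.sum_apply]
    simpa [MvPolynomial.aeval_eq_eval] using this
  rcases exists_gramSum_eq_or_separated Q L₀.toContinuousLinearMap hL₀ (Φ q)
    with ⟨B, hB⟩ | ⟨L, hL, hLq⟩
  · refine absurd ?_ h
    have e := (Fintype.equivFin (Exps d m))
    refine ⟨_, fun k => formOf (B (e.symm k)), fun k => formOf_isHomogeneous _, ?_⟩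
    rw [e.symm.sum_comp fun k => formOf (B k) ^ 2, ← hΦ q hq, ← hB, gramSum]
    simp only [hQ, map_sum, hΦ _ (hsq _)]
  · refine ⟨L.toLinearMap ∘ₗ Φ, fun p hp => ?_, hLq⟩
    have := hL fun α => p.coeff α.1
    rwa [hQ, formOf_coeff hp] at this

/-! ### Partial transposes and squares -/

/-- The type of the part of the word `i` in the tensor factors of `S`. -/
noncomputable def expoOn {n d : ℕ} (S : Finset (Fin n)) (i : MIdx n d) : Fin d →₀ ℕ :=
  ∑ k ∈ S, Finsupp.single (i k) 1

theorem expoOn_add_compl {n d : ℕ} (S : Finset (Fin n)) (i : MIdx n d) :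
    expoOn S i + expoOn Sᶜ i = expo i := Finset.sum_add_sum_compl _ _

theorem expo_merge {n d : ℕ} (S : Finset (Fin n)) (i j : MIdx n d) :
    expo (fun a => if a ∈ S then j a else i a) = expoOn S j + expoOn Sᶜ i := by
  rw [← expoOn_add_compl S, expoOn, expoOn, expoOn, expoOn]
  congr 1
  · exact Finset.sum_congr rfl fun a ha => by rw [if_pos ha]
  · exact Finset.sum_congr rfl fun a ha => by rw [if_neg (Finset.mem_compl.1 ha)]

/-- On real vectors the quadratic form is `L` of a square; the matrix is real symmetric, so real and
imaginary parts of a complex vector contribute separately. -/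
theorem posSemidef_moment {n d : ℕ} {L : MvPolynomial (Fin d) ℝ →ₗ[ℝ] ℝ}
    (hL : ∀ p : MvPolynomial (Fin d) ℝ, p.IsHomogeneous n → 0 ≤ L (p ^ 2)) :
    (Matrix.of fun i j : MIdx n d =>
      (L (MvPolynomial.monomial (expo i + expo j) 1) : ℂ)).PosSemidef := by
  have hre : ∀ w : MIdx n d → ℝ,
      0 ≤ ∑ i, ∑ j, w i * w j * L (MvPolynomial.monomial (expo i + expo j) 1) := fun w => by
    have h := hL (∑ i, MvPolynomial.monomial (expo i) (w i))
      (MvPolynomial.IsHomogeneous.sum _ _ _ fun i _ =>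
        MvPolynomial.isHomogeneous_monomial _ (degree_expo i))
    rw [pow_two, Finset.sum_mul_sum] at h
    simp only [map_sum, MvPolynomial.monomial_mul] at h
    refine h.trans_eq (Finset.sum_congr rfl fun i _ => Finset.sum_congr rfl fun j _ => ?_)
    rw [← smul_eq_mul (w i * w j), ← map_smul, MvPolynomial.smul_monomial, smul_eq_mul, mul_one]
  have hh : (Matrix.of fun i j : MIdx n d =>
      (L (MvPolynomial.monomial (expo i + expo j) 1) : ℂ)).IsHermitian := by
    ext i j
    simp [add_comm]
  refine Matrix.PosSemidef.of_dotProduct_mulVec_nonneg hh fun z => ?_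
  rw [Complex.le_def]
  refine ⟨?_, (hh.im_star_dotProduct_mulVec_self z).symm⟩
  refine (add_nonneg (hre fun i => (z i).re) (hre fun i => (z i).im)).trans_eq ?_
  simp only [dotProduct, Matrix.mulVec, Complex.re_sum, Finset.mul_sum, ← Finset.sum_add_distrib,
    Matrix.of_apply, Pi.star_apply]
  refine Finset.sum_congr rfl fun i _ => Finset.sum_congr rfl fun j _ => ?_
  simp
  ring

/-- Where a partial transpose is supported, the two merged words share a type, which is half of
`expo i + expo j`. Hence it is the Hadamard product of the moment matrix of `L` with the 0/1 matrix
of an equivalence relation, both positive semidefinite. -/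
theorem typeOp_mem_PPT {n d : ℕ} {L : MvPolynomial (Fin d) ℝ →ₗ[ℝ] ℝ}
    (hL : ∀ p : MvPolynomial (Fin d) ℝ, p.IsHomogeneous n → 0 ≤ L (p ^ 2)) :
    (typeOp n fun β => L (MvPolynomial.monomial (2 • β) 1)) ∈ PPT n d := by
  intro k _
  refine ⟨typeOp_mem_hermBos _ _, ?_⟩
  set S := firstFactors n k
  -- The merged words have equal types exactly when this invariant agrees on `i` and `j`.
  let δ : MIdx n d → Fin d → ℤ := fun i c => (expoOn Sᶜ i c : ℤ) - expoOn S i c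
  have hδ : ∀ i j, δ i = δ j ↔ expoOn S j + expoOn Sᶜ i = expoOn S i + expoOn Sᶜ j :=
    fun i j => by
      rw [funext_iff, Finsupp.ext_iff]
      refine forall_congr' fun c => ?_
      simp only [δ, Finsupp.add_apply]
      omega
  have hI : (Matrix.of fun i j : MIdx n d => if δ i = δ j then (1 : ℂ) else 0).PosSemidef := by
    have : (Matrix.of fun i j : MIdx n d => if δ i = δ j then (1 : ℂ) else 0)
        = ∑ t ∈ Finset.univ.image δ, Matrix.vecMulVec (fun i => if δ i = t then (1 : ℂ) else 0)
          (star fun i => if δ i = t then (1 : ℂ) else 0) := by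
      ext i j
      simp only [Matrix.of_apply, Matrix.sum_apply, Matrix.vecMulVec_apply, Pi.star_apply]
      rw [Finset.sum_eq_single (δ i)]
      · by_cases h : δ i = δ j
        · simp [h]
        · simp [h, Ne.symm h]
      · intro t _ ht
        simp [Ne.symm ht]
      · simp
    rw [this]
    exact Matrix.posSemidef_sum _ fun t _ => Matrix.posSemidef_vecMulVec_self_star _
  suffices h : partialTranspose S (typeOp n fun β => L (MvPolynomial.monomial (2 • β) 1))
      = Matrix.hadamard (Matrix.of fun i j : MIdx n d =>
          (L (MvPolynomial.monomial (expo i + expo j) 1) : ℂ))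
        (Matrix.of fun i j : MIdx n d => if δ i = δ j then (1 : ℂ) else 0) by
    rw [h]
    exact (posSemidef_moment hL).hadamard hI
  ext i j
  simp only [partialTranspose, typeOp, Matrix.of_apply, Matrix.hadamard_apply, expo_merge, hδ]
  split_ifs with h
  · have : 2 • (expoOn S j + expoOn Sᶜ i) = expo i + expo j := by
      rw [two_nsmul]
      nth_rewrite 2 [h]
      rw [← expoOn_add_compl S i, ← expoOn_add_compl S j]
      abel
    rw [this, mul_one]
  · rw [mul_zero]

theorem expoOn_firstFactors_append {k l d : ℕ} (a : MIdx k d) (b : MIdx l d) :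
    expoOn (firstFactors (k + l) k) (Fin.append a b) = expo a := by
  rw [expoOn, firstFactors, Finset.sum_filter, Fin.sum_univ_add, expo]
  simp

theorem exists_expoOn_eq {m k d : ℕ} (hk : k ≤ m) {μ ν : Fin d →₀ ℕ} (hμ : μ.degree = k)
    (hν : ν.degree = m - k) :
    ∃ w : MIdx m d, expoOn (firstFactors m k) w = μ ∧ expoOn (firstFactors m k)ᶜ w = ν := by
  obtain ⟨l, rfl⟩ := Nat.exists_eq_add_of_le hk
  obtain ⟨a, rfl⟩ := exists_expo_eq _ μ hμ
  obtain ⟨b, hb⟩ := exists_expo_eq l ν (by rw [hν]; omega)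
  refine ⟨Fin.append a b, expoOn_firstFactors_append a b, ?_⟩
  have h := expoOn_add_compl (firstFactors (k + l) k) (Fin.append a b)
  rw [expoOn_firstFactors_append, expo_append] at h
  rw [add_left_cancel h, hb]

/-- The exponents of `γ` divided by two and rounded down. -/
noncomputable def halfExp {d : ℕ} (γ : Fin d →₀ ℕ) : Fin d →₀ ℕ :=
  γ.mapRange (· / 2) rfl

/-- The moments of even monomials, read off from the diagonal of a bosonic operator. -/
noncomputable def evenMoment {n d : ℕ} (Y : Op n d) (γ : Fin d →₀ ℕ) : ℝ :=
  -- Zero at the other exponents makes monomials of different parity orthogonal.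
  open Classical in if ∀ c, Even (γ c) then typeDiag Y (halfExp γ) else 0

theorem evenMoment_two_nsmul {n d : ℕ} (Y : Op n d) (β : Fin d →₀ ℕ) :
    evenMoment Y (2 • β) = typeDiag Y β := by
  rw [evenMoment, if_pos fun c => by simp]
  congr 1
  ext c
  simp [halfExp]

/-- Split α into its rounded-down and rounded-up halves. The degree of the former is (m - ∑ e)/2,
which depends only on the parities, so one cut `k` serves the whole parity class. -/
theorem exists_word_of_parity {m d : ℕ} (e : Fin d → ℕ) :
    ∃ k ≤ m / 2, ∀ α : Fin d →₀ ℕ, α.degree = m → (fun c => α c % 2) = e →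
      ∃ w : MIdx m d, expoOn (firstFactors m k) w = halfExp α ∧
        expoOn (firstFactors m k)ᶜ w = α - halfExp α := by
  refine ⟨(m - ∑ c, e c) / 2, Nat.div_le_div_right (Nat.sub_le _ _), fun α hα he => ?_⟩
  have h1 : m = ∑ c, e c + 2 * (halfExp α).degree := by
    rw [← hα, ← he, Finsupp.degree_eq_sum, Finsupp.degree_eq_sum, Finset.mul_sum,
      ← Finset.sum_add_distrib]
    exact Finset.sum_congr rfl fun c _ => (Nat.mod_add_div _ _).symm
  have h2 : (halfExp α).degree + (α - halfExp α).degree = m := by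
    rw [← map_add, add_tsub_cancel_of_le, hα]
    exact fun c => Nat.div_le_self _ _
  exact exists_expoOn_eq (by omega) (by omega) (by omega)

/-- For equal parities, ⌊β/2⌋ + ⌈α/2⌉ = (α+β)/2 = ⌊α/2⌋ + ⌈β/2⌉, so after the swap row and column
have the same type. -/
theorem partialTranspose_apply_of_parity {m d : ℕ} {Y : Op m d} (hY : Y ∈ HermBos m d)
    {S : Finset (Fin m)} {α β : Fin d →₀ ℕ} (hp : (fun c => α c % 2) = fun c => β c % 2)
    {u v : MIdx m d} (hu : expoOn S u = halfExp α ∧ expoOn Sᶜ u = α - halfExp α)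
    (hv : expoOn S v = halfExp β ∧ expoOn Sᶜ v = β - halfExp β) :
    (partialTranspose S Y u v).re = evenMoment Y (α + β) := by
  have h1 : halfExp β + (α - halfExp α) = halfExp (α + β) := by
    ext c
    have := congrFun hp c
    simp only [halfExp, Finsupp.add_apply, Finsupp.tsub_apply, Finsupp.mapRange_apply] at *
    omega
  have h2 : halfExp α + (β - halfExp β) = halfExp (α + β) := by
    ext c
    have := congrFun hp c
    simp only [halfExp, Finsupp.add_apply, Finsupp.tsub_apply, Finsupp.mapRange_apply] at *
    omega
  have hev : ∀ c, Even ((α + β) c) := fun c => by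
    have := congrFun hp c
    simp only [Finsupp.add_apply, Nat.even_iff] at *
    omega
  have e1 : expo (fun a => if a ∈ S then v a else u a) = halfExp (α + β) := by
    rw [expo_merge, hv.1, hu.2, h1]
  have e2 : expo (fun a => if a ∈ S then u a else v a) = halfExp (α + β) := by
    rw [expo_merge, hu.1, hv.2, h2]
  rw [evenMoment, if_pos hev, ← e1, ← typeDiag_expo hY, partialTranspose, Matrix.of_apply]
  rw [(symProj_sandwich_iff Y).1 hY.2 _ _ _ _ rfl (e2.trans e1.symm)]

/-- Split `f` by parity class. Cross terms vanish, and each class contributes the quadratic form of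
a submatrix of one partial transpose of `Y`. -/
theorem monFun_evenMoment_sq_nonneg {m d : ℕ} {Y : Op m d} (hY : Y ∈ PPT m d)
    {f : MvPolynomial (Fin d) ℝ} (hf : f.IsHomogeneous m) :
    0 ≤ monFun (evenMoment Y) (f ^ 2) := by
  classical
  let par : (Fin d →₀ ℕ) → Fin d → ℕ := fun α c => α c % 2
  have hdeg : ∀ α ∈ f.support, α.degree = m := fun α hα => by
    rw [Finsupp.degree_eq_weight_one]
    exact hf (MvPolynomial.mem_support_iff.1 hα)
  let z : (Fin d → ℕ) → (Fin d →₀ ℕ) → ℝ := fun e α => if par α = e then f.coeff α else 0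
  have hsplit : monFun (evenMoment Y) (f ^ 2) = ∑ e ∈ f.support.image par,
      ∑ α ∈ f.support, ∑ β ∈ f.support, z e α * z e β * evenMoment Y (α + β) := by
    rw [Finset.sum_comm]
    conv_lhs => rw [f.as_sum, pow_two, Finset.sum_mul_sum, map_sum]
    refine Finset.sum_congr rfl fun α hα => ?_
    rw [map_sum, Finset.sum_comm]
    refine Finset.sum_congr rfl fun β _ => ?_
    rw [MvPolynomial.monomial_mul, monFun_monomial, Finset.sum_eq_single (par α)]
    · by_cases h : par β = par α
      · simp [z, h]
      · have : ¬ ∀ c, Even ((α + β) c) := fun hev => h (funext fun c => by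
          have := hev c
          simp only [Finsupp.add_apply, Nat.even_iff, par] at *
          omega)
        rw [evenMoment, if_neg this, mul_zero, mul_zero]
    · intro e _ he
      simp [z, Ne.symm he]
    · exact fun h => absurd (Finset.mem_image_of_mem par hα) h
  rw [hsplit]
  refine Finset.sum_nonneg fun e _ => ?_
  obtain ⟨k, hk, hw⟩ := exists_word_of_parity (m := m) e
  -- Outside the class any word will do, since the coefficient `z e α` vanishes there.
  have hw' : ∀ α : f.support, ∃ w : MIdx m d, par α = e →
      expoOn (firstFactors m k) w = halfExp α.1 ∧
        expoOn (firstFactors m k)ᶜ w = α.1 - halfExp α.1 := fun α => by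
    by_cases h : par α = e
    · obtain ⟨w, h'⟩ := hw α.1 (hdeg _ α.2) h
      exact ⟨w, fun _ => h'⟩
    · obtain ⟨w, -⟩ := exists_expo_eq m α.1 (hdeg _ α.2)
      exact ⟨w, fun h' => absurd h' h⟩
  choose w hw using hw'
  have hpos := ((hY k hk).2.submatrix w).dotProduct_mulVec_nonneg fun α => (z e α.1 : ℂ)
  refine (Complex.le_def.1 hpos).1.trans_eq ?_
  rw [← Finset.sum_coe_sort]
  simp only [dotProduct, Matrix.mulVec, Complex.re_sum, Finset.mul_sum, Pi.star_apply,
    Matrix.submatrix_apply]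
  refine Finset.sum_congr rfl fun α _ => ?_
  rw [← Finset.sum_coe_sort f.support]
  refine Finset.sum_congr rfl fun β _ => ?_
  by_cases hα : par α = e
  · by_cases hβ : par β = e
    · rw [← partialTranspose_apply_of_parity (hY k hk).1 (hα.trans hβ.symm) (hw α hα) (hw β hβ)]
      simp
      ring
    · simp [z, hβ]
  · simp [z, hα]

/-! ### The PPT case -/

theorem mem_decExtW_iff {n r d : ℕ} {O : Op n d} (hO : O ∈ DS n d) :
    O ∈ DecExtW n r d ↔ wTensor O ∈ toComplex '' RSOS n r d := by
  rw [DecExtW, PPTBExt, mem_conicDual_iff hO _ fun Y hY => (hY 0 (Nat.zero_le _)).1]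
  constructor
  · rintro ⟨T, hTs, hT, h⟩
    refine ⟨T, ⟨hTs, ?_⟩, hT⟩
    rw [expand_polyaPoly]
    by_contra hq
    have hhom : (MvPolynomial.expand 2
        (tensorPoly T * (∑ l : Fin d, MvPolynomial.X l) ^ r)).IsHomogeneous
          ((n + r) + (n + r)) := by
      rw [polyaPoly_eq_sum]
      simp only [map_sum, MvPolynomial.expand_monomial]
      refine MvPolynomial.IsHomogeneous.sum _ _ _ fun l _ =>
        MvPolynomial.IsHomogeneous.sum _ _ _ fun j _ => ?_
      exact MvPolynomial.isHomogeneous_monomial _ (by rw [map_nsmul, degree_expo]; simp; ring)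
    obtain ⟨L, hL, hLq⟩ := exists_functional_of_not_sos hhom hq
    -- This turns `L` of the expanded polynomial into the pairing with the operator whose diagonal
    -- at type β is L(x^(2β)).
    rw [← monFun_comp L, monFun_expand, ← monFun_congr
      (add_comm n r ▸ isHomogeneous_polyaPoly T r) (typeDiag_typeOp (n := r + n) _)] at hLq
    exact hLq.not_ge (h _ (typeOp_mem_PPT fun p hp => hL p (add_comm n r ▸ hp)))
  · rintro ⟨T, ⟨hTs, K, f, hf, h⟩, hT⟩
    refine ⟨T, hTs, hT, fun Y hY => ?_⟩
    have h1 := monFun_expand (evenMoment Y) (tensorPoly T * (∑ l : Fin d, MvPolynomial.X l) ^ r)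
    simp only [evenMoment_two_nsmul] at h1
    rw [← h1, ← expand_polyaPoly, h, map_sum]
    exact Finset.sum_nonneg fun k _ =>
      monFun_evenMoment_sq_nonneg hY (add_comm n r ▸ hf k)

end Dicke

theorem mainTheorem10 (n r d : ℕ) (O : Op n d) (hO : O ∈ DS n d) :
    (O ∈ ExtW n r d ↔ wTensor O ∈ toComplex '' PNN n r d) ∧
    (O ∈ DecExtW n r d ↔ wTensor O ∈ toComplex '' RSOS n r d) :=
  ⟨mem_extW_iff hO, mem_decExtW_iff hO⟩
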